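/- **Setting.** Let $G=H_3(\mathbb R)$ be the group of real upper unitriangular $3\times3$ matrices, $\mathfrak g$ its Lie algebra of strictly upper triangular $3\times 3$ matrices, and $\Gamma=H_3(\mathbb Z)\subset G$ the lattice of matrices with integer entries. Let $P(\mathfrak g)$ be the set of lines (one-dimensional subspaces) of $\mathfrak g$; $G$ acts on it through the adjoint action, written $g\cdot\theta$. For $\theta\in P(\mathfrak g)$ put $\exp(\theta)=\{\exp v: v\in\theta\}$. Let $\theta_t$ $(t\in\mathbb R)$ be the line through $\begin{pmatrix}0&1&t\\0&0&0\\0&0&0\end{pmatrix}$ and $\theta_\infty$ the line through $\begin{pmatrix}0&0&1\\0&0&0\\0&0&0\end{pmatrix}$. Let $T=(T_\gamma)_{\gamma\in\Gamma}$ be a measure preserving action of $\Gamma$ on a $\sigma$-finite standard measure space $(X,\mathfrak B,\mu)$, and let $\mathrm{dist}$ be a right-invariant metric on $G$ compatible with its topology. - $T$ is *recurrent along* $\theta$ if for every $\varepsilon>0$ and every $A\in\mathfrak B$ with $\mu(A)>0$ there are $\gamma\in\Gamma\setminus\{1\}$ and $g\in\exp(\theta)$ with $\mathrm{dist}(\gamma,g)<\varepsilon$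 and $\mu(A\cap T_\gamma A)>0$. - $T$ is *rigid along* $\theta$ if there is a sequence $(\gamma_n)$ in $\Gamma$ with $\gamma_n\to\infty$ (it leaves every finite set), $\inf_{g\in\exp(\theta)}\mathrm{dist}(\gamma_n,g)\to0$, and $\mu(A\cap T_{\gamma_n}A)\to\mu(A)$ for every $A\in\mathfrak B$ of finite measure. - $T$ is *evenly recurrent* (respectively *evenly rigid*) *along* $\theta$ if it is recurrent (respectively rigid) along $g\cdot\theta$ for every $g\in G$. Write $\mathcal R(T)$, $\mathcal Ri(T)$, $\mathcal{ER}(T)$, $\mathcal{ER}i(T)$ for the sets of lines along which $T$ is recurrent, rigid, evenly recurrent, evenly rigid. The action $T$ is *free* if $\mu$-almost every point has trivial stabilizer. It is of *rank one* if there are a (left) Følner sequence of finite sets $F_n\subset\Gamma$ and sets $B_n\in\mathfrak B$ of finite measure such that for each $n$ the sets $T_fB_n$, $f\in F_n$, are pairwise disjoint, and for every $A\in\mathfrak B$ of finite measure there are $P_n\subset F_n$ with $\mu\bigl(A\,\triangle\,\bigcup_{f\in P_n}T_fB_n\bigr)\to0$. **Theorem.** There is a rank-one free measure preserving action $T$ of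 $H_3(\mathbb Z)$ on a $\sigma$-finite standard measure space of infinite measure such that, for every right-invariant metric on $H_3(\mathbb R)$ compatible with the topology, $$\mathcal R(T)=\mathcal Ri(T)=\{\theta_t\mid t\in\mathbb R\}\cup\{\theta_\infty\}=\mathcal{ER}(T)=\mathcal{ER}i(T).$$ In particular, this common set is uncountable. -/

import Mathlib

open Filter Topology MeasureTheory
open scoped Pointwise symmDiff LinearAlgebra.Projectivization

/-- The Heisenberg group `H₃(R)`: the triple `(x, y, z)` stands for the unitriangular matrix
with rows `(1, x, z)`, `(0, 1, y)`, `(0, 0, 1)` (see `Heisenberg.toMatrix`). -/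
@[ext]
structure Heisenberg (R : Type) where
  x : R
  y : R
  z : R

namespace Heisenberg

section Group

variable {R : Type} [CommRing R]

/-- The unitriangular matrix represented by a triple. -/
def toMatrix (g : Heisenberg R) : Matrix (Fin 3) (Fin 3) R :=
  !![1, g.x, g.z; 0, 1, g.y; 0, 0, 1]

instance : Mul (Heisenberg R) := ⟨fun g h => ⟨g.x + h.x, g.y + h.y, g.z + h.z + g.x * h.y⟩⟩
instance : One (Heisenberg R) := ⟨⟨0, 0, 0⟩⟩
instance : Inv (Heisenberg R) := ⟨fun g => ⟨-g.x, -g.y, -g.z + g.x * g.y⟩⟩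

@[simp] theorem mul_x (g h : Heisenberg R) : (g * h).x = g.x + h.x := rfl
@[simp] theorem mul_y (g h : Heisenberg R) : (g * h).y = g.y + h.y := rfl
@[simp] theorem mul_z (g h : Heisenberg R) : (g * h).z = g.z + h.z + g.x * h.y := rfl
@[simp] theorem one_x : (1 : Heisenberg R).x = 0 := rfl
@[simp] theorem one_y : (1 : Heisenberg R).y = 0 := rfl
@[simp] theorem one_z : (1 : Heisenberg R).z = 0 := rfl
@[simp] theorem inv_x (g : Heisenberg R) : g⁻¹.x = -g.x := rfl
@[simp] theorem inv_y (g : Heisenberg R) : g⁻¹.y = -g.y := rfl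
@[simp] theorem inv_z (g : Heisenberg R) : g⁻¹.z = -g.z + g.x * g.y := rfl

instance : Group (Heisenberg R) :=
  Group.ofLeftAxioms
    (by intro a b c; ext <;> simp <;> ring)
    (by intro a; ext <;> simp)
    (by intro a; ext <;> simp)

/-- The group law is matrix multiplication. -/
theorem toMatrix_mul (g h : Heisenberg R) : (g * h).toMatrix = g.toMatrix * h.toMatrix := by
  ext i j
  fin_cases i <;> fin_cases j <;> simp [toMatrix, Matrix.mul_apply, Fin.sum_univ_three] <;> ring

end Group

/-- The inclusion of the lattice `H₃(ℤ)` into `H₃(ℝ)`. -/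
def ofInt : Heisenberg ℤ →* Heisenberg ℝ where
  toFun g := ⟨g.x, g.y, g.z⟩
  map_one' := by ext <;> simp
  map_mul' g h := by ext <;> simp

/-- The lattice `H₃(ℤ)` is a discrete group. -/
instance : MeasurableSpace (Heisenberg ℤ) := ⊤

/-- The usual topology of `H₃(ℝ)`, as a subset of the space of matrices. -/
instance : TopologicalSpace (Heisenberg ℝ) := TopologicalSpace.induced toMatrix inferInstance

/-- The Lie algebra of `H₃(ℝ)`: the vector `(α, β, γ)` stands for the strictly upper triangular
matrix with rows `(0, α, γ)`, `(0, 0, β)`, `(0, 0, 0)` (see `Heisenberg.algToMatrix`). -/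
abbrev Alg : Type := ℝ × ℝ × ℝ

/-- The strictly upper triangular matrix represented by a vector. -/
def algToMatrix (v : Alg) : Matrix (Fin 3) (Fin 3) ℝ :=
  !![0, v.1, v.2.2; 0, 0, v.2.1; 0, 0, 0]

/-- The exponential map of `H₃(ℝ)`. -/
noncomputable def exp (v : Alg) : Heisenberg ℝ := ⟨v.1, v.2.1, v.2.2 + v.1 * v.2.1 / 2⟩

/-- The exponential map is the matrix exponential. -/
theorem toMatrix_exp (v : Alg) : (exp v).toMatrix = NormedSpace.exp (algToMatrix v) := by
  have h3 : algToMatrix v ^ 3 = 0 := by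
    ext i j
    fin_cases i <;> fin_cases j <;>
      simp [algToMatrix, pow_succ, Matrix.mul_apply, Fin.sum_univ_three]
  have h : ∀ n ∉ Finset.range 3,
      ((n.factorial : ℝ)⁻¹) • algToMatrix v ^ n = 0 := by
    intro n hn
    have hn' : 3 ≤ n := by simpa using hn
    rw [pow_eq_zero_of_le hn' h3, smul_zero]
  rw [NormedSpace.exp_eq_tsum ℝ]
  show _ = ∑' n : ℕ, ((n.factorial : ℝ)⁻¹) • algToMatrix v ^ n
  rw [tsum_eq_sum h]
  ext i j
  fin_cases i <;> fin_cases j <;>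
    simp [algToMatrix, toMatrix, exp, Finset.sum_range_succ, pow_succ, Nat.factorial]
  ring

/-- The adjoint action of `H₃(ℝ)` on its Lie algebra. -/
def Ad (g : Heisenberg ℝ) : Alg →ₗ[ℝ] Alg where
  toFun v := (v.1, v.2.1, v.2.2 + g.x * v.2.1 - g.y * v.1)
  map_add' v w := by
    ext <;> simp
    ring
  map_smul' c v := by
    ext <;> simp
    ring

/-- The adjoint action is conjugation of matrices. -/
theorem algToMatrix_Ad (g : Heisenberg ℝ) (v : Alg) :
    algToMatrix (Ad g v) = g.toMatrix * algToMatrix v * g⁻¹.toMatrix := by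
  ext i j
  fin_cases i <;> fin_cases j <;>
    simp [algToMatrix, toMatrix, Ad, Matrix.mul_apply, Fin.sum_univ_three] <;> ring

theorem Ad_injective (g : Heisenberg ℝ) : Function.Injective (Ad g) := by
  rintro ⟨a, b, c⟩ ⟨a', b', c'⟩ h
  simp only [Ad, LinearMap.coe_mk, AddHom.coe_mk, Prod.mk.injEq] at h
  obtain ⟨rfl, rfl, h⟩ := h
  simpa using h

/-- The directions: lines through `0` in the Lie algebra. -/
abbrev Direction : Type := ℙ ℝ Alg

/-- The action `g · θ` of `H₃(ℝ)` on directions induced by the adjoint action. -/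
noncomputable def actOn (g : Heisenberg ℝ) (θ : Direction) : Direction :=
  Projectivization.map (Ad g) (Ad_injective g) θ

/-- The one-parameter subgroup `exp(θ)`. -/
def expLine (θ : Direction) : Set (Heisenberg ℝ) := exp '' (θ.submodule : Set Alg)

/-- The direction `θ_t`, spanned by `(1, 0, t)`. -/
noncomputable def dir (t : ℝ) : Direction :=
  Projectivization.mk ℝ ((1, 0, t) : Alg) (by simp)

/-- The direction `θ_∞`, spanned by `(0, 0, 1)`. -/
noncomputable def dirInf : Direction :=
  Projectivization.mk ℝ ((0, 0, 1) : Alg) (by simp)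

/-- A right-invariant metric on `H₃(ℝ)` compatible with the topology. -/
structure RightInvariantMetric where
  toMetricSpace : MetricSpace (Heisenberg ℝ)
  compatible : toMetricSpace.toPseudoMetricSpace.toUniformSpace.toTopologicalSpace =
    (inferInstance : TopologicalSpace (Heisenberg ℝ))
  dist_mul_right : ∀ g h k : Heisenberg ℝ,
    toMetricSpace.dist (g * k) (h * k) = toMetricSpace.dist g h

/-- The distance between two points for a given right-invariant metric. -/
def RightInvariantMetric.d (m : RightInvariantMetric) (g h : Heisenberg ℝ) : ℝ :=
  m.toMetricSpace.dist g h

section Actions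

variable (m : RightInvariantMetric) {X : Type} [MeasurableSpace X] [MulAction (Heisenberg ℤ) X]
  (μ : Measure X)

/-- The action is recurrent along the direction `θ`. -/
def RecurrentAlong (θ : Direction) : Prop :=
  ∀ ε : ℝ, 0 < ε → ∀ A : Set X, MeasurableSet A → 0 < μ A →
    ∃ γ : Heisenberg ℤ, γ ≠ 1 ∧ ∃ g ∈ expLine θ, m.d (ofInt γ) g < ε ∧ 0 < μ (A ∩ γ • A)

/-- The action is evenly recurrent along `θ`: recurrent along the whole `H₃(ℝ)`-orbit of `θ`. -/
def EvenlyRecurrentAlong (θ : Direction) : Prop :=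
  ∀ g : Heisenberg ℝ, RecurrentAlong m μ (actOn g θ)

/-- The action is rigid along the direction `θ`: for some sequence `γₙ → ∞` in `H₃(ℤ)`, i.e.
leaving every finite set, `dist(γₙ, exp θ) → 0` and the maps `γₙ` converge weakly to the
identity. -/
def RigidAlong (θ : Direction) : Prop :=
  ∃ γ : ℕ → Heisenberg ℤ, Tendsto γ atTop cofinite ∧
    Tendsto (fun n => ⨅ g : expLine θ, m.d (ofInt (γ n)) g) atTop (𝓝 0) ∧
    ∀ A : Set X, MeasurableSet A → μ A < ⊤ →
      Tendsto (fun n => μ (A ∩ γ n • A)) atTop (𝓝 (μ A))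

/-- The action is evenly rigid along `θ`: rigid along the whole `H₃(ℝ)`-orbit of `θ`. -/
def EvenlyRigidAlong (θ : Direction) : Prop :=
  ∀ g : Heisenberg ℝ, RigidAlong m μ (actOn g θ)

end Actions

end Heisenberg

/-- A measure preserving action is free: almost every point has trivial stabilizer. -/
def FreeAction (Γ : Type) [Group Γ] {X : Type} [MeasurableSpace X] [MulAction Γ X]
    (μ : Measure X) : Prop :=
  ∀ᵐ x ∂μ, ∀ γ : Γ, γ • x = x → γ = 1

/-- A measure preserving action of a discrete group `Γ` has rank one: there are a Følner sequence
of finite sets `Fₙ` in `Γ` and sets `Bₙ` of finite measure such that the translates `f • Bₙ`,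
`f ∈ Fₙ`, are pairwise disjoint (the `n`-th Rokhlin tower) and every set of finite measure is
approximated by unions of levels of the `n`-th tower as `n → ∞`. -/
def RankOneAction (Γ : Type) [Group Γ] [MeasurableSpace Γ] {X : Type} [MeasurableSpace X]
    [MulAction Γ X] (μ : Measure X) : Prop :=
  ∃ (F : ℕ → Finset Γ) (B : ℕ → Set X),
    IsFoelner Γ (Measure.count : Measure Γ) atTop (fun n => (F n : Set Γ)) ∧
    (∀ n, MeasurableSet (B n) ∧ μ (B n) < ⊤) ∧
    (∀ n, (F n : Set Γ).PairwiseDisjoint (fun f => f • B n)) ∧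
    ∀ A : Set X, MeasurableSet A → μ A < ⊤ →
      ∃ P : ℕ → Finset Γ, (∀ n, P n ⊆ F n) ∧
        Tendsto (fun n => μ (A ∆ ⋃ f ∈ P n, f • B n)) atTop (𝓝 0)

/-! Complete the lattice 2-adically in `x` and `z` but leave `y` discrete. The result is a locally
compact, noncompact group in which `H₃(ℤ)` is dense; let the lattice act on it by left translation,
with Haar measure. The action is free since the embedding is injective.

Translations by elements tending to `1` converge weakly to the identity. The vectors `(2ⁿk, 0, 2ⁿj)`
tend to `1` in the completion for any integers `k`, `j`, and by Dirichlet's theorem they can be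
taken asymptotic to any line of the ideal `y = 0`; hence rigidity there. Conversely `{y = 0}` is an
open subgroup, so recurrence on it forces `γ.y = 0`, and near a line transversal to the ideal the
only such lattice point is `1` (`exists_forall_eq_one`). The ideal is `Ad`-invariant, so evenness
costs nothing.

For rank one, the cosets of `2ⁿℤ₂ × {0} × 2ⁿℤ₂` indexed by `foelnerBox n` tile `|y| ≤ n` and shrink
in diameter. -/

/-! ### The dyadic completion and its translation action -/

/-- The locally compact group of unitriangular matrices `(x, y, z)` with `x, z ∈ ℤ₂` and
`y ∈ ℤ`. -/
@[ext]
structure DyadicHeisenberg where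
  x : ℤ_[2]
  y : ℤ
  z : ℤ_[2]

namespace DyadicHeisenberg

/-- The coordinates of a triple. -/
def equivProd : DyadicHeisenberg ≃ ℤ_[2] × ℤ × ℤ_[2] where
  toFun g := (g.x, g.y, g.z)
  invFun p := ⟨p.1, p.2.1, p.2.2⟩

noncomputable instance : MetricSpace DyadicHeisenberg :=
  MetricSpace.induced equivProd equivProd.injective inferInstance

theorem dist_def (g h : DyadicHeisenberg) :
    dist g h = max (dist g.x h.x) (max (dist g.y h.y) (dist g.z h.z)) := rfl

/-- The coordinates as a homeomorphism. -/
noncomputable def homeoProd : DyadicHeisenberg ≃ₜ ℤ_[2] × ℤ × ℤ_[2] :=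
  equivProd.toHomeomorphOfIsInducing ⟨rfl⟩

instance : LocallyCompactSpace DyadicHeisenberg :=
  homeoProd.isClosedEmbedding.locallyCompactSpace

instance : PolishSpace DyadicHeisenberg :=
  homeoProd.isClosedEmbedding.polishSpace

noncomputable instance : MeasurableSpace DyadicHeisenberg := borel _
instance : BorelSpace DyadicHeisenberg := ⟨rfl⟩

theorem continuous_x : Continuous DyadicHeisenberg.x :=
  continuous_fst.comp homeoProd.continuous

theorem continuous_y : Continuous DyadicHeisenberg.y :=
  (continuous_fst.comp continuous_snd).comp homeoProd.continuous

theorem continuous_z : Continuous DyadicHeisenberg.z :=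
  (continuous_snd.comp continuous_snd).comp homeoProd.continuous

theorem continuous_mk {Y : Type*} [TopologicalSpace Y] {a : Y → ℤ_[2]} {b : Y → ℤ} {c : Y → ℤ_[2]}
    (ha : Continuous a) (hb : Continuous b) (hc : Continuous c) :
    Continuous (fun y => (⟨a y, b y, c y⟩ : DyadicHeisenberg)) :=
  homeoProd.symm.continuous.comp (ha.prodMk (hb.prodMk hc))

noncomputable instance : Mul DyadicHeisenberg :=
  ⟨fun g h => ⟨g.x + h.x, g.y + h.y, g.z + h.z + g.x * h.y⟩⟩
noncomputable instance : One DyadicHeisenberg := ⟨⟨0, 0, 0⟩⟩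
noncomputable instance : Inv DyadicHeisenberg := ⟨fun g => ⟨-g.x, -g.y, -g.z + g.x * g.y⟩⟩

@[simp] theorem mul_x (g h : DyadicHeisenberg) : (g * h).x = g.x + h.x := rfl
@[simp] theorem mul_y (g h : DyadicHeisenberg) : (g * h).y = g.y + h.y := rfl
@[simp] theorem mul_z (g h : DyadicHeisenberg) : (g * h).z = g.z + h.z + g.x * h.y := rfl
@[simp] theorem one_x : (1 : DyadicHeisenberg).x = 0 := rfl
@[simp] theorem one_y : (1 : DyadicHeisenberg).y = 0 := rfl
@[simp] theorem one_z : (1 : DyadicHeisenberg).z = 0 := rfl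
@[simp] theorem inv_x (g : DyadicHeisenberg) : g⁻¹.x = -g.x := rfl
@[simp] theorem inv_y (g : DyadicHeisenberg) : g⁻¹.y = -g.y := rfl
@[simp] theorem inv_z (g : DyadicHeisenberg) : g⁻¹.z = -g.z + g.x * g.y := rfl

noncomputable instance : Group DyadicHeisenberg :=
  Group.ofLeftAxioms
    (by intro a b c; ext1 <;> simp <;> ring)
    (by intro a; ext1 <;> simp)
    (by intro a; ext1 <;> simp)

instance : IsTopologicalGroup DyadicHeisenberg where
  continuous_mul :=
    continuous_mk ((continuous_x.comp continuous_fst).add (continuous_x.comp continuous_snd))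
      ((continuous_y.comp continuous_fst).add (continuous_y.comp continuous_snd))
      (((continuous_z.comp continuous_fst).add (continuous_z.comp continuous_snd)).add
        ((continuous_x.comp continuous_fst).mul
          (continuous_of_discreteTopology.comp (continuous_y.comp continuous_snd))))
  continuous_inv :=
    continuous_mk continuous_x.neg continuous_y.neg
      (continuous_z.neg.add
        (continuous_x.mul (continuous_of_discreteTopology.comp continuous_y)))

/-- This is what makes the Haar measure infinite. -/
instance : NoncompactSpace DyadicHeisenberg := by
  refine ⟨fun h => noncompact_univ ℤ ?_⟩
  have h' := h.image continuous_y
  rwa [Set.image_univ, Set.range_eq_univ.2 (fun n => ⟨⟨0, n, 0⟩, rfl⟩)] at h'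

/-- The dense embedding of `H₃(ℤ)`. -/
noncomputable def ofHeisenberg : Heisenberg ℤ →* DyadicHeisenberg where
  toFun g := ⟨g.x, g.y, g.z⟩
  map_one' := by ext1 <;> simp
  map_mul' g h := by ext1 <;> simp

@[simp] theorem ofHeisenberg_x (g : Heisenberg ℤ) : (ofHeisenberg g).x = g.x := rfl
@[simp] theorem ofHeisenberg_y (g : Heisenberg ℤ) : (ofHeisenberg g).y = g.y := rfl
@[simp] theorem ofHeisenberg_z (g : Heisenberg ℤ) : (ofHeisenberg g).z = g.z := rfl

noncomputable instance : MulAction (Heisenberg ℤ) DyadicHeisenberg :=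
  MulAction.compHom DyadicHeisenberg ofHeisenberg

theorem smul_eq (γ : Heisenberg ℤ) (g : DyadicHeisenberg) : γ • g = ofHeisenberg γ * g := rfl

instance : ContinuousConstSMul (Heisenberg ℤ) DyadicHeisenberg :=
  ⟨fun γ => continuous_const_mul (ofHeisenberg γ)⟩

instance : MeasurableConstSMul (Heisenberg ℤ) DyadicHeisenberg :=
  ⟨fun γ => (continuous_const_smul γ).measurable⟩

/-- Haar measure on the dyadic Heisenberg group. -/
noncomputable def vol : Measure DyadicHeisenberg := Measure.haar

instance : vol.IsHaarMeasure := inferInstanceAs (Measure.haar (G := DyadicHeisenberg)).IsHaarMeasure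
instance : vol.Regular := inferInstanceAs (Measure.haar (G := DyadicHeisenberg)).Regular
instance : SigmaFinite vol := inferInstanceAs (SigmaFinite (Measure.haar (G := DyadicHeisenberg)))

instance : SMulInvariantMeasure (Heisenberg ℤ) DyadicHeisenberg vol :=
  ⟨fun γ s _ => measure_preimage_mul vol (ofHeisenberg γ) s⟩

theorem vol_univ : vol Set.univ = ⊤ := measure_univ_of_isMulLeftInvariant vol

theorem ofHeisenberg_injective : Function.Injective ofHeisenberg := by
  intro g h e
  have hx : ((g.x : ℤ_[2])) = h.x := congrArg DyadicHeisenberg.x e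
  have hy : g.y = h.y := congrArg DyadicHeisenberg.y e
  have hz : ((g.z : ℤ_[2])) = h.z := congrArg DyadicHeisenberg.z e
  exact Heisenberg.ext (by exact_mod_cast hx) hy (by exact_mod_cast hz)

theorem freeAction : FreeAction (Heisenberg ℤ) vol := by
  refine Eventually.of_forall fun x γ h => ofHeisenberg_injective ?_
  rw [smul_eq, mul_eq_right] at h
  rw [h, map_one]

end DyadicHeisenberg

/-! ### Weak continuity of translations -/

/-- Left translations by elements tending to `1` move sets of finite Haar measure little. -/
theorem tendsto_measure_inter_smul {G : Type*} [TopologicalSpace G] [Group G]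
    [IsTopologicalGroup G] [MeasurableSpace G] [BorelSpace G]
    (μ : Measure G) [μ.IsMulLeftInvariant] [IsLocallyFiniteMeasure μ] [μ.InnerRegularCompactLTTop]
    {g : ℕ → G} (hg : Tendsto g atTop (𝓝 1)) {A : Set G} (hA : MeasurableSet A) (hfin : μ A < ⊤) :
    Tendsto (fun n => μ (A ∩ g n • A)) atTop (𝓝 (μ A)) := by
  -- Currying makes translation continuous into the compact-open topology, in which preimages of a
  -- set under measure preserving maps vary continuously in measure.
  let F : C(G, C(G, G)) := ContinuousMap.curry ⟨fun p : G × G => p.1 * p.2, continuous_mul⟩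
  have hF : Tendsto (fun n => F (g n)⁻¹) atTop (𝓝 (F 1)) := by
    have h1 : Tendsto (fun n => (g n)⁻¹) atTop (𝓝 1) := by simpa using hg.inv
    exact (F.continuous.tendsto 1).comp h1
  have hmp : ∀ a, MeasurePreserving (F a) μ μ := fun a => measurePreserving_mul_left μ a
  have key := tendsto_measure_symmDiff_preimage_nhds_zero hF (Eventually.of_forall fun n => hmp _)
    (hmp 1) hA.nullMeasurableSet hfin.ne
  have e1 : F 1 ⁻¹' A = A := by ext x; simp [F]
  have e2 : ∀ n, F (g n)⁻¹ ⁻¹' A = g n • A := fun n => by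
    ext x; simp [F, Set.mem_smul_set_iff_inv_smul_mem]
  simp only [e1, e2] at key
  have lower : Tendsto (fun n => μ A - μ ((g n • A) ∆ A)) atTop (𝓝 (μ A)) := by
    simpa using ENNReal.Tendsto.sub (tendsto_const_nhds (x := μ A)) key (Or.inl hfin.ne)
  refine tendsto_of_tendsto_of_tendsto_of_le_of_le lower tendsto_const_nhds (fun n => ?_)
    (fun n => measure_mono Set.inter_subset_left)
  refine tsub_le_iff_right.2 ((measure_mono ?_).trans (measure_union_le _ _))
  intro x hx
  by_cases h : x ∈ g n • A
  · exact Or.inl ⟨hx, h⟩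
  · exact Or.inr (Or.inr ⟨hx, h⟩)

/-! ### Right-invariant metrics and the directions of the abelian ideal -/

namespace Heisenberg

theorem continuous_mk {Y : Type*} [TopologicalSpace Y] {a b c : Y → ℝ}
    (ha : Continuous a) (hb : Continuous b) (hc : Continuous c) :
    Continuous (fun y => (⟨a y, b y, c y⟩ : Heisenberg ℝ)) := by
  refine continuous_induced_rng.2 (continuous_matrix fun i j => ?_)
  fin_cases i <;> fin_cases j <;> simp [toMatrix, continuous_const, ha, hb, hc]

theorem continuous_entry (i j : Fin 3) : Continuous fun g : Heisenberg ℝ => g.toMatrix i j :=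
  continuous_induced_dom.matrix_elem i j

theorem continuous_x : Continuous fun g : Heisenberg ℝ => g.x := continuous_entry 0 1
theorem continuous_y : Continuous fun g : Heisenberg ℝ => g.y := continuous_entry 1 2
theorem continuous_z : Continuous fun g : Heisenberg ℝ => g.z := continuous_entry 0 2

namespace RightInvariantMetric

variable (m : RightInvariantMetric)

/-- Right invariance turns closeness of two points into closeness of a quotient to `1`, where only
the topology matters; hence the results hold for every such metric. -/
theorem d_eq (g h : Heisenberg ℝ) : m.d g h = m.d (g * h⁻¹) 1 := by
  rw [d, d, ← m.dist_mul_right g h h⁻¹, mul_inv_cancel]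

theorem d_nonneg (g h : Heisenberg ℝ) : 0 ≤ m.d g h := @dist_nonneg _ m.toMetricSpace.toPseudoMetricSpace g h

theorem nhds_one : @nhds (Heisenberg ℝ)
    m.toMetricSpace.toPseudoMetricSpace.toUniformSpace.toTopologicalSpace 1 = 𝓝 1 := by
  rw [m.compatible]

theorem tendsto_d_one {g : ℕ → Heisenberg ℝ} (hg : Tendsto g atTop (𝓝 1)) :
    Tendsto (fun n => m.d (g n) 1) atTop (𝓝 0) := by
  rw [← m.nhds_one] at hg
  let _ := m.toMetricSpace
  exact tendsto_iff_dist_tendsto_zero.1 hg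

/-- Elements close to `1` for a compatible metric have small coordinates. -/
theorem exists_coord_lt {δ : ℝ} (hδ : 0 < δ) :
    ∃ ε > 0, ∀ g : Heisenberg ℝ, m.d g 1 < ε → |g.x| < δ ∧ |g.y| < δ ∧ |g.z| < δ := by
  have h : {g : Heisenberg ℝ | |g.x| < δ ∧ |g.y| < δ ∧ |g.z| < δ} ∈ 𝓝 (1 : Heisenberg ℝ) := by
    refine IsOpen.mem_nhds ?_ (by simp [hδ])
    exact (isOpen_lt continuous_x.abs continuous_const).inter
      ((isOpen_lt continuous_y.abs continuous_const).inter
        (isOpen_lt continuous_z.abs continuous_const))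
  rw [← m.nhds_one] at h
  let _ := m.toMetricSpace
  obtain ⟨ε, hε, hb⟩ := Metric.mem_nhds_iff.1 h
  exact ⟨ε, hε, fun g hg => hb hg⟩

end RightInvariantMetric

theorem mem_submodule_mk {v : Alg} (hv : v ≠ 0) (w : Alg) :
    w ∈ (Projectivization.mk ℝ v hv : Direction).submodule ↔ ∃ s : ℝ, s • v = w := by
  rw [Projectivization.submodule_mk, Submodule.mem_span_singleton]

/-- The directions spanned by vectors of the abelian ideal `{(α, 0, γ)}`. -/
abbrev idealDirections : Set Direction := Set.range dir ∪ {dirInf}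

theorem dir_injective : Function.Injective dir := by
  intro s t h
  obtain ⟨a, ha⟩ := (Projectivization.mk_eq_mk_iff' ℝ _ _ _ _).1 h
  simp only [Prod.smul_mk, smul_eq_mul, Prod.mk.injEq, mul_one] at ha
  obtain ⟨rfl, -, h3⟩ := ha
  linarith

theorem not_countable_idealDirections : ¬ idealDirections.Countable := by
  intro h
  have h1 := (h.mono Set.subset_union_left).preimage dir_injective
  rw [Set.preimage_range] at h1
  exact Cardinal.not_countable_real h1

theorem mk_mem_idealDirections {v : Alg} (hv : v ≠ 0) (h : v.2.1 = 0) :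
    (Projectivization.mk ℝ v hv : Direction) ∈ idealDirections := by
  obtain ⟨α, β, γ⟩ := v
  obtain rfl : β = 0 := h
  by_cases hα : α = 0
  · subst hα
    have hγ : γ ≠ 0 := by rintro rfl; exact hv rfl
    right
    refine (Projectivization.mk_eq_mk_iff' ℝ _ _ _ _).2 ⟨γ, by simp⟩
  · left
    refine ⟨γ / α, (Projectivization.mk_eq_mk_iff' ℝ _ _ _ _).2 ⟨α⁻¹, ?_⟩⟩
    ext <;> simp [hα]
    field_simp

/-- `Ad g` fixes the middle coordinate, so it preserves the ideal. -/
theorem actOn_mem_idealDirections (g : Heisenberg ℝ) {θ : Direction}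
    (hθ : θ ∈ idealDirections) : actOn g θ ∈ idealDirections := by
  rcases hθ with ⟨t, rfl⟩ | rfl
  · rw [actOn, dir, Projectivization.map_mk]
    exact mk_mem_idealDirections _ rfl
  · rw [actOn, dirInf, Projectivization.map_mk]
    exact mk_mem_idealDirections _ rfl

theorem actOn_one (θ : Direction) : actOn 1 θ = θ := by
  induction θ using Projectivization.ind with
  | h v hv =>
    rw [actOn, Projectivization.map_mk]
    congr 1
    simp [Ad]

end Heisenberg

/-! ### Rigidity implies recurrence; transversal directions -/

namespace Heisenberg

variable (m : RightInvariantMetric)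

theorem RigidAlong.recurrentAlong {X : Type} [MeasurableSpace X] [MulAction (Heisenberg ℤ) X]
    {μ : Measure X} [SigmaFinite μ] {m : RightInvariantMetric} {θ : Direction}
    (h : RigidAlong m μ θ) : RecurrentAlong m μ θ := by
  obtain ⟨γ, hγ, hd, hA⟩ := h
  intro ε hε A hAm hpos
  obtain ⟨B, hBA, hBm, hBpos, hBfin⟩ :
      ∃ B ⊆ A, MeasurableSet B ∧ 0 < μ B ∧ μ B < ⊤ := by
    obtain ⟨B, hBm, hBA, hB0, hB⟩ := Measure.exists_subset_measure_lt_top hAm hpos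
    exact ⟨B, hBA, hBm, hB0, hB⟩
  have h1 : ∀ᶠ n in atTop, γ n ≠ 1 :=
    hγ.eventually ((Set.finite_singleton (1 : Heisenberg ℤ)).compl_mem_cofinite)
  have h2 : ∀ᶠ n in atTop, ⨅ g : expLine θ, m.d (ofInt (γ n)) g < ε := hd.eventually_lt_const hε
  have h3 : ∀ᶠ n in atTop, 0 < μ (B ∩ γ n • B) := (hA B hBm hBfin).eventually_const_lt hBpos
  obtain ⟨n, hn1, hn2, hn3⟩ := (h1.and (h2.and h3)).exists
  -- A real infimum over an empty family would be `0` and yield no point.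
  have : Nonempty (expLine θ) := ⟨⟨exp 0, 0, θ.submodule.zero_mem, rfl⟩⟩
  obtain ⟨g, hg⟩ := exists_lt_of_ciInf_lt hn2
  exact ⟨γ n, hn1, g, g.2, hg, hn3.trans_le
    (measure_mono (Set.inter_subset_inter hBA (Set.smul_set_mono hBA)))⟩

theorem mem_expLine_mk {v : Alg} (hv : v ≠ 0) (g : Heisenberg ℝ) :
    g ∈ expLine (Projectivization.mk ℝ v hv) ↔ ∃ s : ℝ, exp (s • v) = g := by
  simp only [expLine, Set.mem_image, SetLike.mem_coe, mem_submodule_mk]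
  exact ⟨fun ⟨_, ⟨s, hs⟩, h⟩ => ⟨s, hs ▸ h⟩, fun ⟨s, h⟩ => ⟨_, ⟨s, rfl⟩, h⟩⟩

/-- Near a one-parameter subgroup transversal to the abelian ideal, the only lattice point of
the ideal is the identity. -/
theorem exists_forall_eq_one {v : Alg} (hv : v ≠ 0) (h : v.2.1 ≠ 0) :
    ∃ ε > 0, ∀ γ : Heisenberg ℤ, γ.y = 0 →
      ∀ g ∈ expLine (Projectivization.mk ℝ v hv), m.d (ofInt γ) g < ε → γ = 1 := by
  obtain ⟨α, β, c⟩ := v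
  simp only at h
  -- `C` bounds the slopes of the line over its `y`-coordinate. As `γ.y = 0`, the parameter `u = sβ`
  -- is itself small, which keeps all of `exp (s • v)` near `1`.
  set C : ℝ := 1 + |α / β| + |c / β| with hC
  have ha : |α / β| ≤ C := by have := abs_nonneg (c / β); linarith
  have hc : |c / β| ≤ C := by have := abs_nonneg (α / β); linarith
  have hC1 : 1 ≤ C := by have := abs_nonneg (α / β); have := abs_nonneg (c / β); linarith
  obtain ⟨ε, hε, hb⟩ := m.exists_coord_lt (δ := 1 / (8 * C)) (by positivity)
  refine ⟨ε, hε, fun γ hy g hg hd => ?_⟩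
  obtain ⟨s, rfl⟩ := (mem_expLine_mk hv g).1 hg
  rw [m.d_eq] at hd
  obtain ⟨hx, hy', hz⟩ := hb _ hd
  obtain ⟨u, hu⟩ : ∃ u, u = s * β := ⟨_, rfl⟩
  have e1 : s * α = α / β * u := by rw [hu]; field_simp
  have e2 : s * c = c / β * u := by rw [hu]; field_simp
  simp only [mul_x, mul_y, mul_z, inv_x, inv_y, inv_z, exp, ofInt, MonoidHom.coe_mk, OneHom.coe_mk,
    Prod.smul_mk, smul_eq_mul, hy, ← hu, e1, e2] at hx hy' hz
  have hδ : 1 / (8 * C) * C = 1 / 8 := by field_simp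
  have hδ1 : 1 / (8 * C) ≤ 1 / 8 := by
    rw [div_le_div_iff₀ (by positivity) (by positivity)]; linarith
  have hu1 : |u| ≤ 1 / (8 * C) := by simpa using hy'.le
  have hau : |α / β * u| ≤ 1 / 8 := by
    rw [abs_mul, mul_comm, ← hδ]
    exact mul_le_mul hu1 ha (abs_nonneg _) (by positivity)
  have hcu : |c / β * u| ≤ 1 / 8 := by
    rw [abs_mul, mul_comm, ← hδ]
    exact mul_le_mul hu1 hc (abs_nonneg _) (by positivity)
  have hauu : |α / β * u * u| ≤ 1 / 8 := by
    rw [abs_mul]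
    calc _ ≤ (1 / 8 : ℝ) * 1 :=
          mul_le_mul hau (by linarith) (abs_nonneg _) (by norm_num)
      _ = _ := by ring
  have hγx : γ.x = 0 := by
    rw [abs_lt] at hx
    rw [abs_le] at hau
    have h1 : (γ.x : ℝ) < 1 := by linarith
    have h2 : (-1 : ℝ) < γ.x := by linarith
    have h1' : γ.x < 1 := by exact_mod_cast h1
    have h2' : -1 < γ.x := by exact_mod_cast h2
    omega
  have hγz : γ.z = 0 := by
    -- The `z`-coordinate of the quotient contains `γ.x * u`, which must be removed before `γ.z` can
    -- be bounded.
    rw [hγx] at hz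
    rw [abs_lt] at hz
    rw [abs_le] at hcu hauu
    push_cast at hz
    have h1 : (γ.z : ℝ) < 1 := by linarith
    have h2 : (-1 : ℝ) < γ.z := by linarith
    have h1' : γ.z < 1 := by exact_mod_cast h1
    have h2' : -1 < γ.z := by exact_mod_cast h2
    omega
  exact Heisenberg.ext hγx hy hγz

end Heisenberg

/-! ### Recurrent and rigid directions of the translation action -/

namespace DyadicHeisenberg

open Heisenberg

theorem mem_idealDirections_of_recurrentAlong (m : RightInvariantMetric) {θ : Direction}
    (h : RecurrentAlong m vol θ) : θ ∈ idealDirections := by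
  induction θ using Projectivization.ind with
  | h v hv =>
  by_cases hβ : v.2.1 = 0
  · exact mk_mem_idealDirections hv hβ
  exfalso
  obtain ⟨ε, hε, hb⟩ := exists_forall_eq_one m hv hβ
  have hA : IsOpen {g : DyadicHeisenberg | g.y = 0} := (isOpen_discrete {(0 : ℤ)}).preimage continuous_y
  obtain ⟨γ, hγ, g, hg, hd, hpos⟩ := h ε hε _ hA.measurableSet (hA.measure_pos vol ⟨1, rfl⟩)
  obtain ⟨_, hx, y, hy, rfl⟩ := nonempty_of_measure_ne_zero hpos.ne'
  refine hγ (hb γ ?_ g hg hd)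
  have hx' : γ.y + y.y = 0 := hx
  have hy' : y.y = 0 := hy
  omega

/-- Two topologies are involved: convergence to `1` in the dyadic group gives weak convergence,
convergence of quotients in `H₃(ℝ)` gives closeness to the line. -/
theorem rigidAlong_of_tendsto (m : RightInvariantMetric) {θ : Direction} {γ : ℕ → Heisenberg ℤ}
    (hγ : Tendsto γ atTop cofinite) (h1 : Tendsto (fun n => ofHeisenberg (γ n)) atTop (𝓝 1))
    {g : ℕ → Heisenberg ℝ} (hg : ∀ n, g n ∈ expLine θ)
    (hd : Tendsto (fun n => ofInt (γ n) * (g n)⁻¹) atTop (𝓝 1)) : RigidAlong m vol θ := by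
  refine ⟨γ, hγ, ?_, fun A hA hfin => tendsto_measure_inter_smul vol h1 hA hfin⟩
  refine tendsto_of_tendsto_of_tendsto_of_le_of_le tendsto_const_nhds (m.tendsto_d_one hd)
    (fun n => Real.iInf_nonneg fun _ => m.d_nonneg _ _) (fun n => ?_)
  rw [← m.d_eq]
  exact ciInf_le (f := fun x : expLine θ => m.d (ofInt (γ n)) x)
    ⟨0, by rintro _ ⟨x, rfl⟩; exact m.d_nonneg _ _⟩ ⟨g n, hg n⟩

theorem tendsto_two_pow_mul (k : ℕ → ℤ) :
    Tendsto (fun n => (2 : ℤ_[2]) ^ n * k n) atTop (𝓝 0) := by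
  rw [tendsto_zero_iff_norm_tendsto_zero]
  refine squeeze_zero (fun _ => norm_nonneg _) (fun n => ?_)
    (tendsto_pow_atTop_nhds_zero_of_lt_one (r := (2 : ℝ)⁻¹) (by norm_num) (by norm_num))
  have h2 : ‖(2 : ℤ_[2])‖ = 2⁻¹ := by simpa using PadicInt.norm_p (p := 2)
  rw [norm_mul, norm_pow, h2]
  exact mul_le_of_le_one_right (by positivity) (PadicInt.norm_le_one _)

theorem tendsto_ofHeisenberg_two_pow_mul (k j : ℕ → ℤ) :
    Tendsto (fun n => ofHeisenberg ⟨2 ^ n * k n, 0, 2 ^ n * j n⟩) atTop (𝓝 1) := by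
  have h := (tendsto_two_pow_mul k).prodMk_nhds
    ((tendsto_const_nhds (x := (0 : ℤ))).prodMk_nhds (tendsto_two_pow_mul j))
  have h' := (homeoProd.symm.continuous.tendsto (0, 0, 0)).comp h
  refine h'.congr fun n => ?_
  ext1 <;> simp [homeoProd, equivProd]

theorem tendsto_cofinite_of_two_pow_le {f : Heisenberg ℤ → ℤ} {γ : ℕ → Heisenberg ℤ}
    (h : ∀ n, 2 ^ n ≤ f (γ n)) : Tendsto γ atTop cofinite := by
  refine le_cofinite_iff_eventually_ne.2 fun a => ?_
  have : Tendsto (fun n => f (γ n)) atTop atTop :=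
    tendsto_atTop_mono h (tendsto_pow_atTop_atTop_of_one_lt one_lt_two)
  refine eventually_map.2 ?_
  filter_upwards [this.eventually_gt_atTop (f a)] with n hn e
  exact hn.ne' (congrArg f e)

theorem rigidAlong_dirInf (m : RightInvariantMetric) : RigidAlong m vol dirInf := by
  refine rigidAlong_of_tendsto m (γ := fun n => ⟨2 ^ n * 0, 0, 2 ^ n * 1⟩)
    (g := fun n => ofInt ⟨2 ^ n * 0, 0, 2 ^ n * 1⟩)
    (tendsto_cofinite_of_two_pow_le (f := Heisenberg.z) fun n => by simp)
    (tendsto_ofHeisenberg_two_pow_mul _ _) (fun n => ?_) (by simp [tendsto_const_nhds])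
  refine (mem_expLine_mk _ _).2 ⟨2 ^ n, ?_⟩
  ext <;> simp [exp, ofInt]

theorem rigidAlong_dir (m : RightInvariantMetric) (t : ℝ) : RigidAlong m vol (dir t) := by
  -- Dirichlet with denominators up to `4 ^ n`: the error, below `4⁻ⁿ`, is still at most `2⁻ⁿ` after
  -- scaling by `2 ^ n`.
  choose j k hk _ hjk using fun n : ℕ => Real.exists_int_int_abs_mul_sub_le t (n := 4 ^ n) (by positivity)
  refine rigidAlong_of_tendsto m (γ := fun n => ⟨2 ^ n * k n, 0, 2 ^ n * j n⟩)
    (g := fun n => ⟨2 ^ n * k n, 0, 2 ^ n * k n * t⟩)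
    (tendsto_cofinite_of_two_pow_le (f := Heisenberg.x) fun n =>
      le_mul_of_one_le_right (by positivity) (hk n))
    (tendsto_ofHeisenberg_two_pow_mul _ _) (fun n => ?_) ?_
  · refine (mem_expLine_mk _ _).2 ⟨2 ^ n * k n, ?_⟩
    ext <;> simp [exp]
  · have hz : Tendsto (fun n => (2 : ℝ) ^ n * (j n - k n * t)) atTop (𝓝 0) := by
      refine squeeze_zero_norm (fun n => ?_) (tendsto_pow_atTop_nhds_zero_of_lt_one
        (r := (2 : ℝ)⁻¹) (by norm_num) (by norm_num))
      have h4 : (4 : ℝ) ^ n = 2 ^ n * 2 ^ n := by rw [← mul_pow]; norm_num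
      have h := hjk n
      rw [abs_sub_comm] at h
      rw [norm_mul, norm_pow, Real.norm_ofNat, Real.norm_eq_abs, inv_pow]
      calc (2 : ℝ) ^ n * |j n - k n * t| ≤ 2 ^ n * (1 / (((4 ^ n : ℕ) : ℝ) + 1)) := by gcongr
        _ ≤ 2 ^ n * (1 / (2 ^ n * 2 ^ n)) := by
          gcongr
          push_cast
          rw [h4]; linarith
        _ = (2 ^ n)⁻¹ := by field_simp
    have h := ((Heisenberg.continuous_mk continuous_const continuous_const continuous_id :
      Continuous fun z : ℝ => (⟨0, 0, z⟩ : Heisenberg ℝ)).tendsto 0).comp hz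
    refine h.congr fun n => ?_
    ext <;> simp [ofInt]
    ring

theorem rigidAlong_of_mem (m : RightInvariantMetric) {θ : Direction} (h : θ ∈ idealDirections) :
    RigidAlong m vol θ := by
  rcases h with ⟨t, rfl⟩ | rfl
  · exact rigidAlong_dir m t
  · exact rigidAlong_dirInf m

/-- Recurrent directions lie in the ideal, and those of the ideal are evenly rigid. The other two
sets lie in between, taking `g = 1` in the even notions. -/
theorem setOf_along_eq (m : RightInvariantMetric) :
    {θ | RecurrentAlong m vol θ} = idealDirections ∧ {θ | RigidAlong m vol θ} = idealDirections ∧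
    {θ | EvenlyRecurrentAlong m vol θ} = idealDirections ∧
    {θ | EvenlyRigidAlong m vol θ} = idealDirections := by
  have hER : ∀ θ ∈ idealDirections, EvenlyRigidAlong m vol θ := fun θ h g =>
    rigidAlong_of_mem m (actOn_mem_idealDirections g h)
  refine ⟨?_, ?_, ?_, ?_⟩ <;> ext θ
  · exact ⟨mem_idealDirections_of_recurrentAlong m, fun h => (rigidAlong_of_mem m h).recurrentAlong⟩
  · exact ⟨fun h => mem_idealDirections_of_recurrentAlong m h.recurrentAlong, rigidAlong_of_mem m⟩
  · exact ⟨fun h => mem_idealDirections_of_recurrentAlong m (actOn_one θ ▸ h 1),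
      fun h g => (hER θ h g).recurrentAlong⟩
  · exact ⟨fun h => mem_idealDirections_of_recurrentAlong m (actOn_one θ ▸ h 1).recurrentAlong,
      hER θ⟩

end DyadicHeisenberg

/-! ### Følner boxes in `H₃(ℤ)` -/

open Classical in
/-- A sequence of finite subsets of a discrete group is Følner if every translation keeps all but
a negligible proportion of its points inside. -/
theorem isFoelner_count_of_tendsto {G : Type*} [Group G] [MeasurableSpace G]
    [DiscreteMeasurableSpace G] {F : ℕ → Finset G} (hF : ∀ n, (F n).Nonempty)
    (h : ∀ g : G, Tendsto (fun n => (((F n).filter (fun f => g * f ∉ F n)).card : ℝ) / (F n).card)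
      atTop (𝓝 0)) :
    IsFoelner G (Measure.count : Measure G) atTop (fun n => (F n : Set G)) where
  eventually_measurableSet := Eventually.of_forall fun n => .of_discrete
  eventually_meas_ne_zero := Eventually.of_forall fun n => by
    simpa [Measure.count_apply_finset] using (hF n).ne_empty
  eventually_meas_ne_top := Eventually.of_forall fun n => by simp [Measure.count_apply_finset]
  tendsto_meas_smul_symmDiff g := by
    have hlim := (ENNReal.tendsto_ofReal ((h g).add (h g⁻¹)))
    rw [add_zero, ENNReal.ofReal_zero] at hlim
    refine tendsto_of_tendsto_of_tendsto_of_le_of_le tendsto_const_nhds hlim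
      (fun n => zero_le) (fun n => ?_)
    have hc : (0 : ℝ) < (F n).card := by exact_mod_cast (hF n).card_pos
    -- Points of `gF \ F` come from `f` pushed out by `g`, points of `F \ gF` are pushed out by
    -- `g⁻¹`.
    have hsub : (g • (F n : Set G)) ∆ (F n : Set G) ⊆
        ((((F n).filter (fun f => g * f ∉ F n)).image (g * ·) ∪
          (F n).filter (fun f => g⁻¹ * f ∉ F n) : Finset G) : Set G) := by
      rintro _ (⟨⟨f, hf, rfl⟩, hx⟩ | ⟨hx, hx'⟩)
      · exact Finset.mem_coe.2 (Finset.mem_union_left _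
          (Finset.mem_image.2 ⟨f, Finset.mem_filter.2 ⟨hf, hx⟩, rfl⟩))
      · refine Finset.mem_coe.2 (Finset.mem_union_right _ (Finset.mem_filter.2 ⟨hx, fun hg => hx' ?_⟩))
        exact Set.mem_smul_set_iff_inv_smul_mem.2 hg
    have hle : (Measure.count ((g • (F n : Set G)) ∆ (F n : Set G)) : ENNReal) ≤
        ((((F n).filter (fun f => g * f ∉ F n)).card +
          ((F n).filter (fun f => g⁻¹ * f ∉ F n)).card : ℕ) : ENNReal) := by
      refine (measure_mono hsub).trans ?_
      rw [Measure.count_apply_finset]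
      exact_mod_cast (Finset.card_union_le _ _).trans (Nat.add_le_add_right Finset.card_image_le _)
    rw [Measure.count_apply_finset, ← add_div, ENNReal.ofReal_div_of_pos hc, ENNReal.ofReal_natCast]
    refine ENNReal.div_le_div_right (hle.trans_eq ?_) _
    rw [← Nat.cast_add, ENNReal.ofReal_natCast]

namespace Heisenberg

instance : DiscreteMeasurableSpace (Heisenberg ℤ) := ⟨fun _ => trivial⟩

/-- The coordinates of an element of `H₃(ℤ)`. -/
def equivProd : Heisenberg ℤ ≃ ℤ × ℤ × ℤ where
  toFun g := (g.x, g.y, g.z)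
  invFun p := ⟨p.1, p.2.1, p.2.2⟩

/-- The product of three finite sets of integers, as a subset of `H₃(ℤ)`. -/
def box (s t u : Finset ℤ) : Finset (Heisenberg ℤ) :=
  (s ×ˢ t ×ˢ u).map equivProd.symm.toEmbedding

theorem mem_box {s t u : Finset ℤ} {g : Heisenberg ℤ} :
    g ∈ box s t u ↔ g.x ∈ s ∧ g.y ∈ t ∧ g.z ∈ u := by
  simp only [box, Finset.mem_map_equiv, Equiv.symm_symm, Finset.mem_product]
  rfl

theorem card_box (s t u : Finset ℤ) : (box s t u).card = s.card * (t.card * u.card) := by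
  simp [box]

/-- The box `[0, 2ⁿ) × [-n, n] × [0, 2ⁿ)`. -/
noncomputable def foelnerBox (n : ℕ) : Finset (Heisenberg ℤ) :=
  box (Finset.Ico 0 (2 ^ n)) (Finset.Ico (-n) (n + 1)) (Finset.Ico 0 (2 ^ n))

theorem mem_foelnerBox {n : ℕ} {g : Heisenberg ℤ} :
    g ∈ foelnerBox n ↔
      (0 ≤ g.x ∧ g.x < 2 ^ n) ∧ (-n ≤ g.y ∧ g.y < n + 1) ∧ (0 ≤ g.z ∧ g.z < 2 ^ n) := by
  simp [foelnerBox, mem_box]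

theorem card_Ico_two_pow (n : ℕ) : (Finset.Ico (0 : ℤ) (2 ^ n)).card = 2 ^ n := by
  rw [Int.card_Ico, sub_zero]
  exact_mod_cast Int.toNat_natCast (2 ^ n)

theorem card_Ico_neg (n : ℕ) : (Finset.Ico (-n : ℤ) (n + 1)).card = 2 * n + 1 := by
  rw [Int.card_Ico]; omega

/-- The integers of `[lo, hi)` within `m` of one of the ends. -/
noncomputable def edge (lo hi : ℤ) (m : ℕ) : Finset ℤ := Finset.Ico lo (lo + m) ∪ Finset.Ico (hi - m) hi

theorem card_edge_le (lo hi : ℤ) (m : ℕ) : (edge lo hi m).card ≤ 2 * m := by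
  refine (Finset.card_union_le _ _).trans ?_
  simp only [Int.card_Ico]; omega

theorem mem_edge {lo hi a k : ℤ} {m : ℕ} (ha : |a| ≤ m) (hk : lo ≤ k ∧ k < hi)
    (h : ¬ (lo ≤ a + k ∧ a + k < hi)) : k ∈ edge lo hi m := by
  rw [abs_le] at ha
  simp only [edge, Finset.mem_union, Finset.mem_Ico]
  omega

-- A point that leaves the box does so across an edge in some coordinate, one summand each. The
-- shift in `z` is `g.z + g.x * f.y`, with `|f.y| ≤ n`.
open Classical in
theorem card_filter_foelnerBox_le (g : Heisenberg ℤ) (n : ℕ) :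
    ((foelnerBox n).filter (fun f => g * f ∉ foelnerBox n)).card ≤
      2 * g.x.natAbs * ((2 * n + 1) * 2 ^ n) + 2 ^ n * (2 * g.y.natAbs * 2 ^ n) +
        2 ^ n * ((2 * n + 1) * (2 * (g.z.natAbs + g.x.natAbs * n))) := by
  have hsub : (foelnerBox n).filter (fun f => g * f ∉ foelnerBox n) ⊆
      box (edge 0 (2 ^ n) g.x.natAbs) (Finset.Ico (-n) (n + 1)) (Finset.Ico 0 (2 ^ n)) ∪
      box (Finset.Ico 0 (2 ^ n)) (edge (-n) (n + 1) g.y.natAbs) (Finset.Ico 0 (2 ^ n)) ∪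
      box (Finset.Ico 0 (2 ^ n)) (Finset.Ico (-n) (n + 1))
        (edge 0 (2 ^ n) (g.z.natAbs + g.x.natAbs * n)) := by
    intro f hf
    rw [Finset.mem_filter, mem_foelnerBox, mem_foelnerBox] at hf
    obtain ⟨⟨hx, hy, hz⟩, hn⟩ := hf
    simp only [Finset.mem_union, mem_box, Finset.mem_Ico]
    by_cases h1 : 0 ≤ g.x + f.x ∧ g.x + f.x < 2 ^ n
    · by_cases h2 : -n ≤ g.y + f.y ∧ g.y + f.y < n + 1
      · refine Or.inr ⟨hx, hy, mem_edge (a := g.z + g.x * f.y) ?_ hz fun h3 => hn ⟨h1, h2, ?_⟩⟩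
        · have hfy : |f.y| ≤ n := abs_le.2 ⟨hy.1, by omega⟩
          push_cast
          refine (abs_add_le _ _).trans (add_le_add_right ?_ _)
          rw [abs_mul]
          exact mul_le_mul_of_nonneg_left hfy (abs_nonneg _)
        · rw [mul_z, add_right_comm]; exact h3
      · exact Or.inl (Or.inr ⟨hx, mem_edge (by simp) hy h2, hz⟩)
    · exact Or.inl (Or.inl ⟨mem_edge (by simp) hx h1, hy, hz⟩)
  refine (Finset.card_le_card hsub).trans ((Finset.card_union_le _ _).trans
    (add_le_add ((Finset.card_union_le _ _).trans (add_le_add ?_ ?_)) ?_)) <;>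
  · simp only [card_box, card_Ico_two_pow, card_Ico_neg]
    gcongr
    exact card_edge_le _ _ _

/-- The shear moves `z` by `O(n)`, negligible against the side `2 ^ n`; this is why the `y`-side
grows only linearly. -/
theorem isFoelner_foelnerBox :
    IsFoelner (Heisenberg ℤ) (Measure.count : Measure (Heisenberg ℤ)) atTop
      (fun n => (foelnerBox n : Set (Heisenberg ℤ))) := by
  classical
  refine isFoelner_count_of_tendsto (fun n => ⟨1, mem_foelnerBox.2 (by simp)⟩) fun g => ?_
  have h2 : Tendsto (fun n : ℕ => ((2 : ℝ) ^ n)⁻¹) atTop (𝓝 0) :=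
    (tendsto_pow_atTop_atTop_of_one_lt one_lt_two).inv_tendsto_atTop
  have hn2 : Tendsto (fun n : ℕ => (n : ℝ) * ((2 : ℝ) ^ n)⁻¹) atTop (𝓝 0) := by
    simpa [div_eq_mul_inv] using
      tendsto_pow_const_div_const_pow_of_one_lt 1 (one_lt_two (α := ℝ))
  have hn : Tendsto (fun n : ℕ => (2 * (n : ℝ) + 1)⁻¹) atTop (𝓝 0) :=
    (tendsto_atTop_add_const_right _ _
      (tendsto_natCast_atTop_atTop.const_mul_atTop two_pos)).inv_tendsto_atTop
  have hlim : Tendsto (fun n : ℕ => 2 * (g.x.natAbs : ℝ) * ((2 : ℝ) ^ n)⁻¹ +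
      2 * g.y.natAbs * (2 * (n : ℝ) + 1)⁻¹ +
      (2 * g.z.natAbs * ((2 : ℝ) ^ n)⁻¹ + 2 * g.x.natAbs * (n * ((2 : ℝ) ^ n)⁻¹))) atTop (𝓝 0) := by
    simpa using ((h2.const_mul _).add (hn.const_mul _)).add ((h2.const_mul _).add (hn2.const_mul _))
  refine squeeze_zero (fun n => by positivity) (fun n => ?_) hlim
  have hcard : ((foelnerBox n).card : ℝ) = 2 ^ n * ((2 * n + 1) * 2 ^ n) := by
    rw [foelnerBox, card_box, card_Ico_two_pow, card_Ico_neg]; push_cast; rfl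
  have hle : (((foelnerBox n).filter (fun f => g * f ∉ foelnerBox n)).card : ℝ) ≤ _ :=
    Nat.cast_le.2 (card_filter_foelnerBox_le g n)
  rw [hcard, div_le_iff₀ (by positivity)]
  refine hle.trans_eq ?_
  push_cast
  field_simp

end Heisenberg

/-! ### Rokhlin towers and rank one -/

namespace DyadicHeisenberg

open Heisenberg

/-- The base `2ⁿℤ₂ × {0} × 2ⁿℤ₂` of the `n`-th tower. -/
def base (n : ℕ) : Set DyadicHeisenberg :=
  {g | ‖g.x‖ ≤ (2 : ℝ) ^ (-n : ℤ) ∧ g.y = 0 ∧ ‖g.z‖ ≤ (2 : ℝ) ^ (-n : ℤ)}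

theorem isClosed_base (n : ℕ) : IsClosed (base n) :=
  (isClosed_le continuous_x.norm continuous_const).inter
    ((isClosed_eq continuous_y continuous_const).inter
      (isClosed_le continuous_z.norm continuous_const))

theorem isCompact_base (n : ℕ) : IsCompact (base n) := by
  have h : IsCompact (Set.univ ×ˢ {0} ×ˢ Set.univ : Set (ℤ_[2] × ℤ × ℤ_[2])) :=
    isCompact_univ.prod (isCompact_singleton.prod isCompact_univ)
  refine (h.image homeoProd.symm.continuous).of_isClosed_subset (isClosed_base n) fun g hg => ?_
  exact ⟨(g.x, g.y, g.z), ⟨trivial, hg.2.1, trivial⟩, rfl⟩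

/-- The shear term `f.x * b.y` vanishes on the base, so levels are products of balls. -/
theorem mem_smul_base {n : ℕ} {f : Heisenberg ℤ} {g : DyadicHeisenberg} :
    g ∈ f • base n ↔
      ‖g.x - f.x‖ ≤ (2 : ℝ) ^ (-n : ℤ) ∧ g.y = f.y ∧ ‖g.z - f.z‖ ≤ (2 : ℝ) ^ (-n : ℤ) := by
  constructor
  · rintro ⟨b, ⟨hx, hy, hz⟩, rfl⟩
    exact ⟨by simpa [smul_eq] using hx, by simp [smul_eq, hy], by simpa [smul_eq, hy] using hz⟩
  · rintro ⟨hx, hy, hz⟩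
    exact ⟨⟨g.x - f.x, 0, g.z - f.z⟩, ⟨hx, rfl, hz⟩, by ext1 <;> simp [smul_eq, hy]⟩

theorem _root_.PadicInt.norm_sub_le_max {p : ℕ} [Fact p.Prime] (u v : ℤ_[p]) :
    ‖u - v‖ ≤ max ‖u‖ ‖v‖ := by
  simpa [sub_eq_add_neg] using PadicInt.nonarchimedean u (-v)

/-- The integers of `[0, 2ⁿ)` represent `ℤ₂ / 2ⁿℤ₂` uniquely, whence disjoint levels. -/
theorem eq_of_norm_sub_le {n : ℕ} {a b : ℤ} {w : ℤ_[2]} (ha : 0 ≤ a ∧ a < 2 ^ n)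
    (hb : 0 ≤ b ∧ b < 2 ^ n) (hwa : ‖w - a‖ ≤ (2 : ℝ) ^ (-n : ℤ))
    (hwb : ‖w - b‖ ≤ (2 : ℝ) ^ (-n : ℤ)) : a = b := by
  have h : ‖((a - b : ℤ) : ℤ_[2])‖ ≤ ((2 : ℕ) : ℝ) ^ (-n : ℤ) := by
    have e : ((a - b : ℤ) : ℤ_[2]) = (w - b) - (w - a) := by push_cast; ring
    rw [e]
    exact (PadicInt.norm_sub_le_max _ _).trans (max_le hwb hwa)
  rw [PadicInt.norm_int_le_pow_iff_dvd] at h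
  push_cast at h
  have := Int.eq_zero_of_abs_lt_dvd h (abs_lt.2 ⟨by omega, by omega⟩)
  omega

theorem exists_norm_sub_le (n : ℕ) (w : ℤ_[2]) :
    ∃ a : ℤ, (0 ≤ a ∧ a < 2 ^ n) ∧ ‖w - a‖ ≤ (2 : ℝ) ^ (-n : ℤ) := by
  refine ⟨w.appr n, ⟨by positivity, by exact_mod_cast w.appr_lt n⟩, ?_⟩
  exact_mod_cast (PadicInt.norm_le_pow_iff_mem_span_pow _ n).2 (PadicInt.appr_spec n w)

theorem pairwiseDisjoint_smul_base (n : ℕ) :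
    (foelnerBox n : Set (Heisenberg ℤ)).PairwiseDisjoint (fun f => f • base n) := by
  intro f hf f' hf' hne
  refine Set.disjoint_left.2 fun g hg hg' => hne ?_
  obtain ⟨hx, -, hz⟩ := mem_foelnerBox.1 hf
  obtain ⟨hx', -, hz'⟩ := mem_foelnerBox.1 hf'
  obtain ⟨kx, ky, kz⟩ := mem_smul_base.1 hg
  obtain ⟨kx', ky', kz'⟩ := mem_smul_base.1 hg'
  exact Heisenberg.ext (eq_of_norm_sub_le hx hx' kx kx') (ky.symm.trans ky')
    (eq_of_norm_sub_le hz hz' kz kz')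

theorem exists_mem_smul_base {n : ℕ} {g : DyadicHeisenberg} (hg : |g.y| ≤ n) :
    ∃ f ∈ foelnerBox n, g ∈ f • base n := by
  obtain ⟨a, ha, ha'⟩ := exists_norm_sub_le n g.x
  obtain ⟨c, hc, hc'⟩ := exists_norm_sub_le n g.z
  rw [abs_le] at hg
  exact ⟨⟨a, g.y, c⟩, mem_foelnerBox.2 ⟨ha, ⟨hg.1, Int.lt_add_one_of_le hg.2⟩, hc⟩, mem_smul_base.2 ⟨ha', rfl, hc'⟩⟩

theorem dist_le_of_mem_smul_base {n : ℕ} {f : Heisenberg ℤ} {g h : DyadicHeisenberg}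
    (hg : g ∈ f • base n) (hh : h ∈ f • base n) : dist g h ≤ (2 : ℝ) ^ (-n : ℤ) := by
  obtain ⟨kx, ky, kz⟩ := mem_smul_base.1 hg
  obtain ⟨kx', ky', kz'⟩ := mem_smul_base.1 hh
  have key : ∀ {u v w : ℤ_[2]}, ‖u - w‖ ≤ (2 : ℝ) ^ (-n : ℤ) → ‖v - w‖ ≤ (2 : ℝ) ^ (-n : ℤ) →
      dist u v ≤ (2 : ℝ) ^ (-n : ℤ) := fun {u v w} hu hv => by
    rw [dist_eq_norm, ← sub_sub_sub_cancel_right u v w]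
    exact (PadicInt.norm_sub_le_max _ _).trans (max_le hu hv)
  rw [dist_def, ky, ky', dist_self]
  exact max_le (key kx kx') (max_le (by positivity) (key kz kz'))

open Classical in
/-- A compact set is covered, within any neighbourhood, by levels of the late towers. -/
theorem eventually_exists_levels {K U : Set DyadicHeisenberg} (hK : IsCompact K) (hU : IsOpen U)
    (hKU : K ⊆ U) : ∀ᶠ n in atTop, ∃ P ⊆ foelnerBox n,
      K ⊆ ⋃ f ∈ P, f • base n ∧ ⋃ f ∈ P, f • base n ⊆ U := by
  obtain ⟨δ, hδ, hthick⟩ := hK.exists_thickening_subset_open hU hKU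
  obtain ⟨C, hC⟩ := (hK.image (continuous_abs.comp continuous_y)).bddAbove
  have hsmall : ∀ᶠ n : ℕ in atTop, (2 : ℝ) ^ (-n : ℤ) < δ := by
    have : Tendsto (fun n : ℕ => ((2 : ℝ) ^ n)⁻¹) atTop (𝓝 0) :=
      (tendsto_pow_atTop_atTop_of_one_lt one_lt_two).inv_tendsto_atTop
    simpa using this.eventually_lt_const hδ
  filter_upwards [hsmall, eventually_ge_atTop C.toNat] with n hn hCn
  -- Take the levels meeting `K`: the tower reaches height `C ≥ |y|`, and levels of diameter below
  -- `δ` stay in the thickening.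
  refine ⟨(foelnerBox n).filter fun f => (f • base n ∩ K).Nonempty, Finset.filter_subset _ _,
    fun g hg => ?_, Set.iUnion₂_subset fun f hf h hh => hthick ?_⟩
  · have hy : |g.y| ≤ C := hC ⟨g, hg, rfl⟩
    obtain ⟨f, hf, hgf⟩ := exists_mem_smul_base (n := n) (g := g) (by omega)
    exact Set.mem_biUnion (Finset.mem_coe.2 (Finset.mem_filter.2 ⟨hf, g, hgf, hg⟩)) hgf
  · obtain ⟨g, hgf, hgK⟩ := (Finset.mem_filter.1 hf).2
    exact Metric.mem_thickening_iff.2 ⟨g, hgK, (dist_le_of_mem_smul_base hh hgf).trans_lt hn⟩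

/-- By regularity, squeeze `A` between a compact `K` and an open `U`; levels covering `K` inside `U`
err only on `A \ K` and `U \ A`. -/
theorem eventually_exists_measure_symmDiff_le {A : Set DyadicHeisenberg} (hA : MeasurableSet A)
    (hfin : vol A < ⊤) {ε : ENNReal} (hε : 0 < ε) :
    ∀ᶠ n in atTop, ∃ P ⊆ foelnerBox n, vol (A ∆ ⋃ f ∈ P, f • base n) ≤ ε := by
  have hε2 : ε / 2 ≠ 0 := (ENNReal.half_pos hε.ne').ne'
  obtain ⟨K, hKA, hK, hKμ⟩ := hA.exists_isCompact_sdiff_lt hfin.ne hε2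
  obtain ⟨U, hAU, hU, -, hUμ⟩ := hA.exists_isOpen_sdiff_lt hfin.ne hε2
  filter_upwards [eventually_exists_levels hK hU (hKA.trans hAU)] with n ⟨P, hP, hKP, hPU⟩
  refine ⟨P, hP, (measure_mono (t := (A \ K) ∪ (U \ A)) ?_).trans
    ((measure_union_le _ _).trans ((add_le_add hKμ.le hUμ.le).trans_eq (ENNReal.add_halves ε)))⟩
  exact Set.union_subset_union (Set.sdiff_subset_sdiff_right hKP) (Set.sdiff_subset_sdiff_left hPU)

theorem rankOneAction : RankOneAction (Heisenberg ℤ) vol := by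
  refine ⟨foelnerBox, base, isFoelner_foelnerBox, fun n => ⟨(isClosed_base n).measurableSet,
    (isCompact_base n).measure_lt_top⟩, pairwiseDisjoint_smul_base, fun A hA hfin => ?_⟩
  -- An optimal `P` for each `n` gives one sequence that serves every `ε`.
  choose P hP hmin using fun n => (foelnerBox n).powerset.exists_min_image
    (fun P => vol (A ∆ ⋃ f ∈ P, f • base n)) ⟨∅, Finset.empty_mem_powerset _⟩
  refine ⟨P, fun n => Finset.mem_powerset.1 (hP n), ENNReal.tendsto_nhds_zero.2 fun ε hε => ?_⟩
  filter_upwards [eventually_exists_measure_symmDiff_le hA hfin hε] with n ⟨Q, hQ, hQε⟩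
  exact (hmin n Q (Finset.mem_powerset.2 hQ)).trans hQε

end DyadicHeisenberg

theorem theorem6p3 :
    ∃ (X : Type) (_ : MeasurableSpace X) (_ : StandardBorelSpace X)
      (_ : MulAction (Heisenberg ℤ) X) (_ : MeasurableConstSMul (Heisenberg ℤ) X)
      (μ : Measure X) (_ : SigmaFinite μ) (_ : SMulInvariantMeasure (Heisenberg ℤ) X μ),
      μ Set.univ = ⊤ ∧
      FreeAction (Heisenberg ℤ) μ ∧
      RankOneAction (Heisenberg ℤ) μ ∧
      (∀ m : Heisenberg.RightInvariantMetric,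
        {θ | Heisenberg.RecurrentAlong m μ θ} =
          Set.range Heisenberg.dir ∪ {Heisenberg.dirInf} ∧
        {θ | Heisenberg.RigidAlong m μ θ} =
          Set.range Heisenberg.dir ∪ {Heisenberg.dirInf} ∧
        {θ | Heisenberg.EvenlyRecurrentAlong m μ θ} =
          Set.range Heisenberg.dir ∪ {Heisenberg.dirInf} ∧
        {θ | Heisenberg.EvenlyRigidAlong m μ θ} =
          Set.range Heisenberg.dir ∪ {Heisenberg.dirInf}) ∧
      ¬ (Set.range Heisenberg.dir ∪ {Heisenberg.dirInf}).Countable :=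
  ⟨DyadicHeisenberg, inferInstance, inferInstance, inferInstance, inferInstance,
    DyadicHeisenberg.vol, inferInstance, inferInstance, DyadicHeisenberg.vol_univ,
    DyadicHeisenberg.freeAction, DyadicHeisenberg.rankOneAction, DyadicHeisenberg.setOf_along_eq,
    Heisenberg.not_countable_idealDirections⟩
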